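/- Let $(\mathcal{T},\otimes,\mathbb{1})$ be a compactly generated tensor triangulated category. That is: $\mathcal{T}$ is a triangulated category with set-indexed coproducts and a symmetric monoidal structure whose tensor product is exact and preserves set-indexed coproducts in each variable; $\mathcal{T}$ is generated by a set of compact objects; the unit $\mathbb{1}$ is compact; every compact object $X$ is strongly dualizable, i.e. the canonical morphism $\mathcal{H}om(X,\mathbb{1})\otimes Y\to\mathcal{H}om(X,Y)$ is an isomorphism for all $Y$, where $\mathcal{H}om(X,-)$ is the right adjoint of $X\otimes-$; and the functor $\mathcal{H}om(-,Y)$ is exact for each $Y$. Let $\mathcal{T}^c$ be the full subcategory of compact objects, and let $\mathrm{Th}(\mathcal{T}^c)$ be the complete lattice, ordered by inclusion, of thick subcategories $\mathsf{C}\subseteq\mathcal{T}^c$ that are tensor closed ($X\in\mathsf{C}$ and $Y\in\mathcal{T}^c$ imply $X\otimes Y\in\mathsf{C}$). Let $\mathrm{Sp}(\mathcal{T}^c)$ be the set of prime elements of $\mathrm{Th}(\mathcal{T}^c)$, that is, of those $\mathsf{P}\neq\mathcal{T}^c$ such that $\mathsf{C}\cap\mathsf{D}\subseteq\mathsf{P}$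 implies $\mathsf{C}\subseteq\mathsf{P}$ or $\mathsf{D}\subseteq\mathsf{P}$, with the Stone topology, whose open sets are exactly the sets $U(\mathsf{C})=\{\mathsf{P}\mid\mathsf{C}\not\subseteq\mathsf{P}\}$ for $\mathsf{C}\in\mathrm{Th}(\mathcal{T}^c)$. For $X\in\mathcal{T}^c$ put $\mathrm{supp}_{\mathcal{T}^c}(X)=\{\mathsf{P}\in\mathrm{Sp}(\mathcal{T}^c)\mid X\notin\mathsf{P}\}$. Then $\mathrm{Sp}(\mathcal{T}^c)$ is a spectral topological space, and the map $$\mathsf{C}\longmapsto\mathrm{supp}_{\mathcal{T}^c}(\mathsf{C})=\bigcup_{X\in\mathsf{C}}\mathrm{supp}_{\mathcal{T}^c}(X)$$ is an inclusion-preserving bijection, with inclusion-preserving inverse, from the set of tensor closed thick subcategories of $\mathcal{T}^c$ onto the set of open subsets of $\mathrm{Sp}(\mathcal{T}^c)$. -/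

import Mathlib

open CategoryTheory Limits MonoidalCategory Pretriangulated Opposite

universe v u

/-! ### The spectrum of a lattice -/

/-- The prime elements of a complete lattice `L`: those `p ≠ 1` such that `a ∧ b ≤ p` implies
`a ≤ p` or `b ≤ p`. -/
def PrimeSp (L : Type*) [CompleteLattice L] : Type _ :=
  {p : L // p ≠ ⊤ ∧ ∀ a b : L, a ⊓ b ≤ p → a ≤ p ∨ b ≤ p}

namespace PrimeSp

variable {L : Type*} [CompleteLattice L]

/-- The set `U(a)` of all primes `p` with `a ≰ p`. -/
def U (a : L) : Set (PrimeSp L) := {p | ¬ a ≤ p.1}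

/-- The Stone topology: the open sets are exactly the sets `U(a)`. -/
instance : TopologicalSpace (PrimeSp L) where
  IsOpen s := ∃ a : L, s = U a
  isOpen_univ := ⟨⊤, by
    ext p
    simp only [Set.mem_univ, U, Set.mem_ofPred_eq, top_le_iff, true_iff]
    exact p.2.1⟩
  isOpen_inter := by
    rintro _ _ ⟨a, rfl⟩ ⟨b, rfl⟩
    refine ⟨a ⊓ b, ?_⟩
    ext p
    simp only [U, Set.mem_inter_iff, Set.mem_ofPred_eq]
    constructor
    · rintro ⟨ha, hb⟩ h
      exact (p.2.2 a b h).elim ha hb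
    · intro h
      exact ⟨fun ha => h (inf_le_left.trans ha), fun hb => h (inf_le_right.trans hb)⟩
  isOpen_sUnion := by
    intro S hS
    refine ⟨sSup {a | U a ∈ S}, ?_⟩
    ext p
    simp only [Set.mem_sUnion, U, Set.mem_ofPred_eq, sSup_le_iff, not_forall]
    constructor
    · rintro ⟨t, ht, hp⟩
      obtain ⟨a, rfl⟩ := hS t ht
      exact ⟨a, ht, hp⟩
    · rintro ⟨a, ha, hp⟩
      exact ⟨_, ha, hp⟩

end PrimeSp

/-! ### Exact functors and compact objects -/

/-- A functor between triangulated categories is exact if it admits an isomorphism with the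
shifts for which it preserves distinguished triangles. -/
def IsExactFunctor {C D : Type*} [Category* C] [Category* D] [HasZeroObject C] [HasZeroObject D]
    [HasShift C ℤ] [HasShift D ℤ] [Preadditive C] [Preadditive D]
    [∀ n : ℤ, (shiftFunctor C n).Additive] [∀ n : ℤ, (shiftFunctor D n).Additive]
    [Pretriangulated C] [Pretriangulated D] (F : C ⥤ D) : Prop :=
  ∃ _ : F.CommShift ℤ, F.IsTriangulated

/-- The canonical map `⨁ Hom(X, Y j) → Hom(X, ∐ Y j)`. -/
noncomputable def sumHomToHomSigma {T : Type u} [Category.{v} T] [Preadditive T]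
    [HasCoproducts.{v} T] (X : T) {J : Type v} (Y : J → T) :
    (DirectSum J fun j => (X ⟶ Y j)) →+ (X ⟶ ∐ Y) :=
  open Classical in DirectSum.toAddMonoid fun j => Preadditive.rightComp X (Sigma.ι Y j)

/-- An object `X` is compact if `Hom(X, -)` preserves set-indexed coproducts. -/
def IsCompactObj {T : Type u} [Category.{v} T] [Preadditive T] [HasCoproducts.{v} T] :
    ObjectProperty T :=
  fun X => ∀ (J : Type v) (Y : J → T), Function.Bijective (sumHomToHomSigma X Y)

/-! ### Internal homs and strongly dualizable objects -/

section InternalHom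

variable {T : Type u} [Category.{v} T] [MonoidalCategory T]

/-- The object `H` with the evaluation `ev : X ⊗ H ⟶ Y` is an internal hom from `X` to `Y`:
`Hom(Z, H) ≅ Hom(X ⊗ Z, Y)` for all `Z`. -/
def IsInternalHom {X Y H : T} (ev : X ⊗ H ⟶ Y) : Prop :=
  ∀ Z : T, Function.Bijective fun g : Z ⟶ H => X ◁ g ≫ ev

/-- `X` is strongly dualizable: with `D = Hom(X, 𝟙)` and `ev : X ⊗ D ⟶ 𝟙` its evaluation,
the canonical morphism `D ⊗ Y ⟶ Hom(X, Y)` is an isomorphism for all `Y`. That morphism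
is the one adjoint to `X ⊗ (D ⊗ Y) ⟶ Y` below, so it is an isomorphism precisely if the latter
makes `D ⊗ Y` an internal hom from `X` to `Y`. -/
def IsStronglyDualizable (X : T) : Prop :=
  ∃ (D : T) (ev : X ⊗ D ⟶ 𝟙_ T), IsInternalHom ev ∧
    ∀ Y : T, IsInternalHom ((α_ X D Y).inv ≫ ev ▷ Y ≫ (λ_ Y).hom)

/-- The contravariant functor `F`, with the evaluations `ev X : X ⊗ F X ⟶ Y`, is the internal
hom functor `X ↦ Hom(X, Y)`. -/
def IsInternalHomFunctor (Y : T) (F : Tᵒᵖ ⥤ T) (ev : ∀ X : T, X ⊗ F.obj (op X) ⟶ Y) : Prop :=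
  (∀ X : T, IsInternalHom (ev X)) ∧
    ∀ ⦃X X' : T⦄ (f : X ⟶ X'), X ◁ F.map f.op ≫ ev X = f ▷ F.obj (op X') ≫ ev X'

end InternalHom

/-! ### Tensor triangulated categories -/

section TensorTriangulated

variable (T : Type u) [Category.{v} T] [HasZeroObject T] [HasShift T ℤ] [Preadditive T]
  [∀ n : ℤ, (shiftFunctor T n).Additive] [Pretriangulated T] [MonoidalCategory T]

/-- The tensor product is exact and preserves set-indexed coproducts in each variable. -/
class IsTensorTriangulated : Prop where
  exact_left : ∀ X : T, IsExactFunctor (tensorLeft X)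
  exact_right : ∀ X : T, IsExactFunctor (tensorRight X)
  coproducts_left : ∀ (X : T) (J : Type v), PreservesColimitsOfShape (Discrete J) (tensorLeft X)
  coproducts_right : ∀ (X : T) (J : Type v), PreservesColimitsOfShape (Discrete J) (tensorRight X)

open scoped Pretriangulated.Opposite in
/-- Compactly generated tensor triangulated categories. The existence of the internal homs
is a consequence of `compactly_generated` (Brown representability), so `exact_hom` does not
postulate it. -/
class IsCompactlyGeneratedTT [HasCoproducts.{v} T] : Prop extends IsTensorTriangulated T where
  /-- There is a set of compact objects that generates `T`. -/
  compactly_generated : ∃ (I : Type v) (G : I → T), (∀ i, IsCompactObj (G i)) ∧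
    ∀ X : T, (∀ (i : I) (n : ℤ) (f : (G i)⟦n⟧ ⟶ X), f = 0) → IsZero X
  unit_compact : IsCompactObj (𝟙_ T)
  dualizable : ∀ X : T, IsCompactObj X → IsStronglyDualizable X
  /-- For every `Y` the functor `Hom(-, Y)` is exact. -/
  exact_hom : ∀ (Y : T) (F : Tᵒᵖ ⥤ T) (ev : ∀ X : T, X ⊗ F.obj (op X) ⟶ Y),
    IsInternalHomFunctor Y F ev → IsExactFunctor F

/-- A tensor closed thick subcategory of the category `T^c` of compact objects, given by its
objects: it is a triangulated subcategory, closed under retracts, and contains `X ⊗ Y` whenever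
it contains `X` and `Y` is compact. -/
@[ext]
structure TensorThick [HasCoproducts.{v} T] where
  prop : ObjectProperty T
  le_compact : ∀ X, prop X → IsCompactObj X
  triangulated : prop.IsTriangulated
  retracts : prop.IsStableUnderRetracts
  tensor : ∀ X Y : T, prop X → IsCompactObj Y → prop (X ⊗ Y)

end TensorTriangulated

/-! ### The compact objects form a tensor closed thick subcategory -/

section Compact

variable {T : Type u} [Category.{v} T] [Preadditive T] [HasCoproducts.{v} T]

theorem sumHomToHomSigma_apply (X : T) {J : Type v} (Y : J → T)
    (x : DirectSum J fun j => (X ⟶ Y j)) (s : Finset J) (hs : ∀ j, j ∉ s → x j = 0) :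
    sumHomToHomSigma X Y x = ∑ j ∈ s, x j ≫ Sigma.ι Y j := by
  classical
  have hx : x = ∑ j ∈ s, DirectSum.of (fun j => (X ⟶ Y j)) j (x j) := by
    ext k
    rw [DFinsupp.finsetSum_apply]
    by_cases hk : k ∈ s
    · rw [Finset.sum_eq_single k]
      · exact (DirectSum.of_eq_same (β := fun j => (X ⟶ Y j)) k _).symm
      · intro b _ hb
        exact DirectSum.of_eq_of_ne (β := fun j => (X ⟶ Y j)) _ _ _ hb.symm
      · exact fun h => absurd hk h
    · rw [hs k hk, Finset.sum_eq_zero]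
      intro b hb
      exact DirectSum.of_eq_of_ne (β := fun j => (X ⟶ Y j)) _ _ _ (fun h => hk (h ▸ hb))
  conv_lhs => rw [hx]
  rw [map_sum]
  refine Finset.sum_congr rfl fun j _ => ?_
  exact DirectSum.toAddMonoid_of (fun j => Preadditive.rightComp X (Sigma.ι Y j)) j (x j)

/-- `X` is compact if and only if every morphism from `X` to a coproduct is a finite sum of
morphisms through the summands. -/
theorem isCompactObj_iff (X : T) : IsCompactObj X ↔ ∀ (J : Type v) (Y : J → T) (f : X ⟶ ∐ Y),
    ∃ (s : Finset J) (g : ∀ j, X ⟶ Y j), f = ∑ j ∈ s, g j ≫ Sigma.ι Y j := by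
  classical
  constructor
  · intro h J Y f
    obtain ⟨x, rfl⟩ := (h J Y).2 f
    exact ⟨DFinsupp.support x, fun j => x j,
      sumHomToHomSigma_apply X Y x _ fun j hj => by simpa using hj⟩
  · intro h J Y
    constructor
    · rw [injective_iff_map_eq_zero]
      intro x hx
      ext k
      rw [sumHomToHomSigma_apply X Y x (DFinsupp.support x) fun j hj => by simpa using hj] at hx
      have h2 := congrArg (fun f => f ≫ Sigma.π Y k) hx
      simp only [Preadditive.sum_comp, Category.assoc, zero_comp] at h2
      by_cases hk : k ∈ DFinsupp.support x
      · rw [Finset.sum_eq_single k] at h2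
        · simpa using h2
        · intro b _ hb
          rw [Sigma.ι_π_of_ne _ hb, comp_zero]
        · exact fun h => absurd hk h
      · simpa using hk
    · intro f
      obtain ⟨s, g, rfl⟩ := h J Y f
      refine ⟨DFinsupp.mk s fun j => g j, ?_⟩
      rw [sumHomToHomSigma_apply X Y _ s]
      · refine Finset.sum_congr rfl fun j hj => ?_
        congr 1
        exact (DFinsupp.mk_of_mem hj)
      · intro j hj
        exact DFinsupp.mk_of_notMem hj

/-- The idempotent endomorphism of a coproduct given by a finite set of summands. -/
noncomputable def sigmaTrunc {J : Type v} (Y : J → T) (s : Finset J) : ∐ Y ⟶ ∐ Y :=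
  open Classical in ∑ j ∈ s, Sigma.π Y j ≫ Sigma.ι Y j

theorem ι_sigmaTrunc {J : Type v} (Y : J → T) {s : Finset J} {j : J} (hj : j ∈ s) :
    Sigma.ι Y j ≫ sigmaTrunc Y s = Sigma.ι Y j := by
  classical
  have h : sigmaTrunc Y s = ∑ j ∈ s, Sigma.π Y j ≫ Sigma.ι Y j := by
    unfold sigmaTrunc
    refine Finset.sum_congr rfl fun _ _ => ?_
    congr!
  rw [h, Preadditive.comp_sum, Finset.sum_eq_single j]
  · simp
  · intro b _ hb
    rw [Sigma.ι_π_of_ne_assoc _ hb.symm, zero_comp]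
  · exact fun h => absurd hj h

theorem isCompactObj_iff_trunc (X : T) : IsCompactObj X ↔
    ∀ (J : Type v) (Y : J → T) (f : X ⟶ ∐ Y), ∃ s : Finset J, f ≫ sigmaTrunc Y s = f := by
  classical
  rw [isCompactObj_iff]
  constructor
  · intro h J Y f
    obtain ⟨s, g, rfl⟩ := h J Y f
    refine ⟨s, ?_⟩
    rw [Preadditive.sum_comp]
    refine Finset.sum_congr rfl fun j hj => ?_
    rw [Category.assoc, ι_sigmaTrunc Y hj]
  · intro h J Y f
    obtain ⟨s, hs⟩ := h J Y f
    refine ⟨s, fun j => f ≫ Sigma.π Y j, ?_⟩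
    conv_lhs => rw [← hs]
    unfold sigmaTrunc
    rw [Preadditive.comp_sum]
    refine Finset.sum_congr rfl fun j _ => ?_
    rw [Category.assoc]

theorem sigmaTrunc_comp {J : Type v} (Y : J → T) {s t : Finset J} (hst : s ⊆ t) :
    sigmaTrunc Y s ≫ sigmaTrunc Y t = sigmaTrunc Y s := by
  conv_lhs => enter [1]; unfold sigmaTrunc
  rw [Preadditive.sum_comp]
  conv_rhs => unfold sigmaTrunc
  refine Finset.sum_congr rfl fun j hj => ?_
  rw [Category.assoc, ι_sigmaTrunc Y (hst hj)]

/-- If every morphism from `A` arises, naturally in the target, from a morphism from a compact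
object `X` to the value of a coproduct preserving functor, then `A` is compact. -/
theorem IsCompactObj.of_surjective {A X : T} (hX : IsCompactObj X) (F : T ⥤ T)
    (hF : ∀ J : Type v, PreservesColimitsOfShape (Discrete J) F)
    (φ : ∀ W : T, (X ⟶ F.obj W) → (A ⟶ W)) (hφ : ∀ W, Function.Surjective (φ W))
    (hnat : ∀ (W W' : T) (g : X ⟶ F.obj W) (h : W ⟶ W'), φ W' (g ≫ F.map h) = φ W g ≫ h) :
    IsCompactObj A := by
  rw [isCompactObj_iff_trunc]
  intro J Y f
  obtain ⟨g, rfl⟩ := hφ _ f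
  have := hF J
  obtain ⟨s, k, hk⟩ := (isCompactObj_iff X).1 hX J (fun j => F.obj (Y j))
    (g ≫ (PreservesCoproduct.iso F Y).hom)
  refine ⟨s, ?_⟩
  have hg : g = ∑ j ∈ s, k j ≫ F.map (Sigma.ι Y j) := by
    rw [← cancel_mono (PreservesCoproduct.iso F Y).hom, hk, Preadditive.sum_comp]
    refine Finset.sum_congr rfl fun j _ => ?_
    rw [Category.assoc]
    congr 1
    rw [← Iso.comp_inv_eq, PreservesCoproduct.inv_hom, ι_comp_sigmaComparison]
  rw [← hnat]
  congr 1
  rw [hg, Preadditive.sum_comp]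
  refine Finset.sum_congr rfl fun j hj => ?_
  rw [Category.assoc, ← F.map_comp, ι_sigmaTrunc Y hj]

theorem isCompactObj_retracts : (IsCompactObj (T := T)).IsStableUnderRetracts where
  of_retract {A X} r hX := hX.of_surjective (𝟭 T) (fun J => inferInstance)
    (fun W g => r.i ≫ g) (fun W f => ⟨r.r ≫ f, by simp⟩) (fun W W' g h => by simp)

/-- The tensor product of a strongly dualizable and a compact object is compact. -/
theorem IsCompactObj.tensor [MonoidalCategory T]
    (hT : ∀ (X : T) (J : Type v), PreservesColimitsOfShape (Discrete J) (tensorLeft X))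
    {X Y : T} (hX : IsStronglyDualizable X) (hY : IsCompactObj Y) : IsCompactObj (X ⊗ Y) := by
  obtain ⟨D, ev, -, h⟩ := hX
  refine hY.of_surjective (tensorLeft D) (hT D)
    (fun W g => X ◁ g ≫ (α_ X D W).inv ≫ ev ▷ W ≫ (λ_ W).hom) (fun W => (h W Y).2) ?_
  intro W W' g k
  change X ◁ (g ≫ D ◁ k) ≫ _ = _
  simp only [MonoidalCategory.whiskerLeft_comp, Category.assoc]
  congr 1
  rw [MonoidalCategory.associator_inv_naturality_right_assoc,
    MonoidalCategory.whisker_exchange_assoc, MonoidalCategory.leftUnitor_naturality]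

theorem isCompactObj_triangulated [HasZeroObject T] [HasShift T ℤ]
    [∀ n : ℤ, (shiftFunctor T n).Additive] [Pretriangulated T] :
    (IsCompactObj (T := T)).IsTriangulated where
  exists_zero := ⟨_, isZero_zero T, by
    rw [isCompactObj_iff]
    intro J Y f
    exact ⟨∅, fun _ => 0, (isZero_zero T).eq_of_src _ _⟩⟩
  isStableUnderShiftBy n := ⟨fun X hX =>
    hX.of_surjective (shiftFunctor T (-n)) (fun J => inferInstance)
      (fun W g => ((shiftEquiv T n).toAdjunction.homEquiv X W).symm g)
      (fun W => ((shiftEquiv T n).toAdjunction.homEquiv X W).symm.surjective)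
      (fun W W' g h => (shiftEquiv T n).toAdjunction.homEquiv_naturality_right_symm g h)⟩
  ext₂' A hA h₁ h₃ := ObjectProperty.le_isoClosure _ _ (by
    classical
    rw [isCompactObj_iff_trunc] at h₁ h₃ ⊢
    intro J Y f
    obtain ⟨s, hs⟩ := h₁ J Y (A.mor₁ ≫ f)
    obtain ⟨g, hg⟩ := Triangle.yoneda_exact₂ A hA (f - f ≫ sigmaTrunc Y s) (by
      rw [Preadditive.comp_sub, ← Category.assoc, hs, sub_self])
    obtain ⟨t, ht⟩ := h₃ J Y g
    refine ⟨s ∪ t, ?_⟩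
    have hf : f = f ≫ sigmaTrunc Y s + A.mor₂ ≫ g := by rw [← hg]; abel
    have h1 : (f ≫ sigmaTrunc Y s) ≫ sigmaTrunc Y (s ∪ t) = f ≫ sigmaTrunc Y s := by
      rw [Category.assoc, sigmaTrunc_comp Y Finset.subset_union_left]
    have h2 : (A.mor₂ ≫ g) ≫ sigmaTrunc Y (s ∪ t) = A.mor₂ ≫ g := by
      rw [Category.assoc, ← ht, Category.assoc, sigmaTrunc_comp Y Finset.subset_union_right]
    conv_lhs => rw [hf]
    rw [Preadditive.add_comp, h1, h2, ← hf])

end Compact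

/-! ### The lattice of tensor closed thick subcategories and its spectrum -/

namespace TensorThick

variable {T : Type u} [Category.{v} T] [HasZeroObject T] [HasShift T ℤ] [Preadditive T]
  [∀ n : ℤ, (shiftFunctor T n).Additive] [Pretriangulated T] [MonoidalCategory T]
  [HasCoproducts.{v} T]

/-- The order is inclusion. -/
instance : PartialOrder (TensorThick T) :=
  PartialOrder.lift TensorThick.prop fun _ _ h => TensorThick.ext h

/-- The intersection, inside the category of compact objects, of a set of tensor closed thick
subcategories. -/
def inter [IsCompactlyGeneratedTT T] (S : Set (TensorThick T)) : TensorThick T where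
  prop := fun X => IsCompactObj X ∧ ∀ C ∈ S, C.prop X
  le_compact _ h := h.1
  triangulated :=
    have := isCompactObj_triangulated (T := T)
    have := isCompactObj_retracts (T := T)
    { exists_zero := ⟨_, isZero_zero T, ObjectProperty.prop_zero _, fun C _ =>
        have := C.triangulated
        have := C.retracts
        C.prop.prop_zero⟩
      isStableUnderShiftBy := fun n => ⟨fun X hX =>
        ⟨(IsCompactObj (T := T)).le_shift n X hX.1, fun C hC =>
          have := C.triangulated
          C.prop.le_shift n X (hX.2 C hC)⟩⟩
      ext₂' := fun A hA h₁ h₃ => ObjectProperty.le_isoClosure _ _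
        ⟨ObjectProperty.ext_of_isTriangulatedClosed₂ _ A hA h₁.1 h₃.1, fun C hC =>
          have := C.triangulated
          have := C.retracts
          C.prop.ext_of_isTriangulatedClosed₂ A hA (h₁.2 C hC) (h₃.2 C hC)⟩ }
  retracts :=
    { of_retract := fun r h => ⟨isCompactObj_retracts.of_retract r h.1,
        fun C hC => C.retracts.of_retract r (h.2 C hC)⟩ }
  tensor X Y hX hY := ⟨IsCompactObj.tensor IsTensorTriangulated.coproducts_left
    (IsCompactlyGeneratedTT.dualizable X hX.1) hY, fun C hC => C.tensor X Y (hX.2 C hC) hY⟩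

/-- The complete lattice `Th(T^c)`; infima are intersections. -/
instance [IsCompactlyGeneratedTT T] : CompleteLattice (TensorThick T) :=
  letI : InfSet (TensorThick T) := ⟨inter⟩
  completeLatticeOfInf (TensorThick T) fun _ =>
    ⟨fun C hC _ hX => hX.2 C hC, fun D hD X hX => ⟨D.le_compact X hX, fun _ hC => hD hC X hX⟩⟩

end TensorThick

section Support

variable {T : Type u} [Category.{v} T] [HasZeroObject T] [HasShift T ℤ] [Preadditive T]
  [∀ n : ℤ, (shiftFunctor T n).Additive] [Pretriangulated T] [MonoidalCategory T]
  [HasCoproducts.{v} T] [IsCompactlyGeneratedTT T]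

/-- The support `{P ∈ Sp(T^c) | X ∉ P}` of a compact object `X`. -/
def suppObj (X : (IsCompactObj (T := T)).FullSubcategory) : Set (PrimeSp (TensorThick T)) :=
  {P | ¬ P.1.prop X.obj}

/-- The support of a tensor closed thick subcategory, the union of the supports of its objects. -/
def TensorThick.supp (C : TensorThick T) : Set (PrimeSp (TensorThick T)) :=
  ⋃ (X : (IsCompactObj (T := T)).FullSubcategory) (_ : C.prop X.obj), suppObj X

end Support

/-! ### Spatiality and spectrality -/

/-! The theorem is Stone duality for a coherent lattice. In a distributive lattice generated by
compact elements, Zorn's lemma supplies enough primes to separate elements (`exists_prime_not_le`),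
so `U` is an isomorphism onto the opens of the spectrum (`opensIso`), under which compact elements
become quasi-compact opens. If moreover the compact elements include the top and are closed under
binary meets, the spectrum is spectral.

For `Th(T^c)`, rigidity is the key input: a compact `X` is a retract of `X ⊗ D ⊗ X` with compact
dual `D`, so `X ⊗ X ∈ C` forces `X ∈ C` (`prop_of_prop_tensor_self`). Together with the ideals
`colon C Z`, this gives distributivity (`inf_sup_le`) and shows that the meet of two principal
ideals is principal (`gen_inf_gen`). The compact elements are exactly the principal ideals, because
finitely many generators can be replaced by their sum. Finally, `supp C` is `U C`. -/

theorem IsCompactElement.map_orderIso {α β : Type*} [PartialOrder α] [PartialOrder β] (e : α ≃o β)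
    {a : α} (ha : IsCompactElement a) : IsCompactElement (e a) := by
  intro s u hs hdir hu hle
  obtain ⟨_, ⟨x, hx, rfl⟩, hax⟩ := ha (e.symm '' s) (e.symm u) (hs.image _)
    (directedOn_image.2 (hdir.mono fun _ _ h => e.symm.monotone h)) (e.symm.isLUB_image'.2 hu)
    (e.le_symm_apply.2 hle)
  exact ⟨x, hx, e.le_symm_apply.1 hax⟩

theorem isCompactElement_map_iff {α β : Type*} [PartialOrder α] [PartialOrder β] (e : α ≃o β)
    {a : α} : IsCompactElement (e a) ↔ IsCompactElement a :=
  ⟨fun h => by simpa using h.map_orderIso e.symm, fun h => h.map_orderIso e⟩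

namespace PrimeSp

variable {L : Type*} [CompleteLattice L]

theorem isOpen_U (a : L) : IsOpen (U a) := ⟨a, rfl⟩

theorem U_mono {a b : L} (h : a ≤ b) : U a ⊆ U b := fun _ hp hb => hp (h.trans hb)

theorem U_inf (a b : L) : U (a ⊓ b) = U a ∩ U b := by
  ext p
  exact ⟨fun h => ⟨fun ha => h (inf_le_left.trans ha), fun hb => h (inf_le_right.trans hb)⟩,
    fun h hab => (p.2.2 a b hab).elim h.1 h.2⟩

theorem U_sSup (S : Set L) : U (sSup S) = ⋃ a ∈ S, U a := by
  ext p
  simp [U]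

theorem U_top : U (⊤ : L) = Set.univ :=
  Set.eq_univ_of_forall fun p h => p.2.1 (top_le_iff.1 h)

instance : T0Space (PrimeSp L) := by
  refine ⟨fun p q h => Subtype.ext ?_⟩
  have key (a : L) : a ≤ p.1 ↔ a ≤ q.1 := not_iff_not.1 (h.mem_open_iff (isOpen_U a))
  exact le_antisymm ((key _).1 le_rfl) ((key _).2 le_rfl)

/-- An element that is maximal among those not above a compact element is prime. -/
theorem exists_prime_not_le [IsCompactlyGenerated L]
    (hdist : ∀ a b c : L, a ⊓ (b ⊔ c) ≤ a ⊓ b ⊔ a ⊓ c) {a b : L} (hab : ¬ a ≤ b) :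
    ∃ p : PrimeSp L, b ≤ p.1 ∧ ¬ a ≤ p.1 := by
  rw [le_iff_compact_le_imp] at hab
  push Not at hab
  obtain ⟨c, hc, hca, hcb⟩ := hab
  -- Compactness of `c` keeps it from lying below the supremum of a chain unless it lies below a
  -- member.
  obtain ⟨p, hbp, hp⟩ := zorn_le_nonempty₀ {x : L | ¬ c ≤ x} (by
    intro s hs hchain y hy
    refine ⟨sSup s, fun hcs => ?_, fun _ => le_sSup⟩
    obtain ⟨x, hx, hcx⟩ := hc s _ ⟨y, hy⟩ hchain.directedOn (isLUB_sSup s) hcs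
    exact hs hx hcx) b hcb
  have hcp : ¬ c ≤ p := hp.1
  have hmax (x : L) (hx : ¬ x ≤ p) : c ≤ p ⊔ x := by
    by_contra h
    exact hx (le_sup_right.trans (hp.2 h le_sup_left))
  refine ⟨⟨p, fun h => hcp (h ▸ le_top), fun x y hxy => ?_⟩, hbp, fun h => hcp (hca.trans h)⟩
  by_contra! h
  let _ : DistribLattice L := DistribLattice.ofInfSupLe hdist
  -- By distributivity `c ≤ (p ⊔ x) ⊓ (p ⊔ y) = p ⊔ (x ⊓ y) = p`, a contradiction.
  refine hcp ((le_inf (hmax x h.1) (hmax y h.2)).trans ?_)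
  rw [← sup_inf_left]
  exact sup_le le_rfl hxy

theorem U_subset_U_iff [IsCompactlyGenerated L]
    (hdist : ∀ a b c : L, a ⊓ (b ⊔ c) ≤ a ⊓ b ⊔ a ⊓ c) {a b : L} : U a ⊆ U b ↔ a ≤ b := by
  refine ⟨fun h => ?_, U_mono⟩
  by_contra hab
  obtain ⟨p, hbp, hap⟩ := exists_prime_not_le hdist hab
  exact h hap hbp

/-- A distributive compactly generated lattice is isomorphic to the lattice of open sets of its
spectrum. -/
noncomputable def opensIso [IsCompactlyGenerated L]
    (hdist : ∀ a b c : L, a ⊓ (b ⊔ c) ≤ a ⊓ b ⊔ a ⊓ c) :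
    L ≃o TopologicalSpace.Opens (PrimeSp L) :=
  RelIso.ofSurjective
    (OrderEmbedding.ofMapLEIff
      (fun a => (⟨U a, isOpen_U a⟩ : TopologicalSpace.Opens (PrimeSp L)))
      fun _ _ => U_subset_U_iff hdist) fun s => by
    obtain ⟨a, ha⟩ := s.isOpen
    exact ⟨a, TopologicalSpace.Opens.ext ha.symm⟩

theorem coe_opensIso [IsCompactlyGenerated L]
    (hdist : ∀ a b c : L, a ⊓ (b ⊔ c) ≤ a ⊓ b ⊔ a ⊓ c) (a : L) :
    (opensIso hdist a : Set (PrimeSp L)) = U a := rfl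

/-- Quasi-compactness of an open set is compactness in the lattice of opens, which an order
isomorphism preserves. -/
theorem isCompact_U_iff [IsCompactlyGenerated L]
    (hdist : ∀ a b c : L, a ⊓ (b ⊔ c) ≤ a ⊓ b ⊔ a ⊓ c) {a : L} :
    IsCompact (U a) ↔ IsCompactElement a := by
  have h := TopologicalSpace.Opens.isCompactElement_iff (opensIso hdist a)
  rw [coe_opensIso] at h
  rw [← h]
  exact (isCompactElement_map_iff (opensIso hdist))

/-- A closed set has the form `{q | p ≤ q}`; irreducibility makes `p` itself prime, and then `p` is
the generic point. -/
theorem quasiSober [IsCompactlyGenerated L]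
    (hdist : ∀ a b c : L, a ⊓ (b ⊔ c) ≤ a ⊓ b ⊔ a ⊓ c) : QuasiSober (PrimeSp L) := by
  refine ⟨fun {S} hS hcl => ?_⟩
  obtain ⟨p, hp⟩ := hcl.isOpen_compl
  have hS' : S = {q : PrimeSp L | p ≤ q.1} := by
    rw [← compl_compl S, hp]
    ext q
    simp [U]
  have hmem (a : L) : (S ∩ U a).Nonempty ↔ ¬ a ≤ p := by
    rw [← U_subset_U_iff hdist, ← hp, Set.subset_compl_iff_disjoint_left,
      Set.not_disjoint_iff_nonempty_inter]
  let P : PrimeSp L := ⟨p, by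
    rintro rfl
    rw [U_top, Set.compl_univ_iff] at hp
    exact hS.nonempty.ne_empty hp, fun a b hab => by
      by_contra! h
      have := hS.2 _ _ (isOpen_U a) (isOpen_U b) ((hmem a).2 h.1) ((hmem b).2 h.2)
      rw [← U_inf, hmem] at this
      exact this hab⟩
  refine ⟨P, (isGenericPoint_iff_specializes).2 fun q => ?_⟩
  rw [specializes_iff_forall_open, hS']
  constructor
  · intro h
    by_contra hq
    exact h _ (isOpen_U p) hq le_rfl
  · rintro hq _ ⟨a, rfl⟩ ha hap
    exact ha (hap.trans hq)

/-- The spectrum of a coherent lattice is spectral. -/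
theorem spectralSpace [IsCompactlyGenerated L]
    (hdist : ∀ a b c : L, a ⊓ (b ⊔ c) ≤ a ⊓ b ⊔ a ⊓ c)
    (htop : IsCompactElement (⊤ : L))
    (hinf : ∀ a b : L, IsCompactElement a → IsCompactElement b → IsCompactElement (a ⊓ b)) :
    SpectralSpace (PrimeSp L) where
  __ := (inferInstance : T0Space (PrimeSp L))
  __ := quasiSober hdist
  isCompact_univ := by
    rw [← U_top]
    exact (isCompact_U_iff hdist).2 htop
  inter_isCompact := by
    rintro _ _ ⟨a, rfl⟩ ha ⟨b, rfl⟩ hb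
    rw [isCompact_U_iff hdist] at ha hb
    rw [← U_inf]
    exact (isCompact_U_iff hdist).2 (hinf a b ha hb)
  isTopologicalBasis := by
    refine TopologicalSpace.isTopologicalBasis_of_isOpen_of_nhds (fun s hs => hs.1) ?_
    rintro p _ hp ⟨a, rfl⟩
    obtain ⟨S, hS, rfl⟩ := IsCompactlyGenerated.exists_sSup_eq a
    rw [U_sSup] at hp
    obtain ⟨b, hb, hpb⟩ := Set.mem_iUnion₂.1 hp
    exact ⟨U b, ⟨isOpen_U b, (isCompact_U_iff hdist).2 (hS b hb)⟩, hpb, U_mono (le_sSup hb)⟩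

end PrimeSp

/-! ### Duals of compact objects -/

/-- A strongly dualizable object has a dual. -/
theorem IsStronglyDualizable.exists_exactPairing {T : Type u} [Category.{v} T]
    [MonoidalCategory T] {X : T} (hX : IsStronglyDualizable X) :
    ∃ D : T, Nonempty (ExactPairing D X) := by
  obtain ⟨D, ev, hev, h⟩ := hX
  -- The coevaluation is the adjoint of the identity of `X`, up to unitors. One triangle identity is
  -- its defining equation.
  obtain ⟨η, hη⟩ := (h X (𝟙_ T)).2 (ρ_ X).hom
  replace hη : X ◁ η ≫ (α_ X D X).inv ≫ ev ▷ X ≫ (λ_ X).hom = (ρ_ X).hom := hη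
  refine ⟨D, ⟨⟨η, ev, ?_, ?_⟩⟩⟩
  · rw [← cancel_mono (λ_ X).hom]
    simpa using hη
  -- The other triangle identity is tested after pairing with `ev`, where it reduces to the first.
  · have key : η ▷ D ≫ (α_ D X D).hom ≫ D ◁ ev ≫ (ρ_ D).hom = (λ_ D).hom := by
      refine (hev _).1 ?_
      change X ◁ (η ▷ D ≫ (α_ D X D).hom ≫ D ◁ ev ≫ (ρ_ D).hom) ≫ ev = X ◁ (λ_ D).hom ≫ ev
      calc
        _ = 𝟙 _ ⊗≫ (X ◁ η) ▷ D ⊗≫ ((X ⊗ D) ◁ ev ≫ ev ▷ (𝟙_ T)) ⊗≫ 𝟙 _ := by monoidal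
        _ = 𝟙 _ ⊗≫ (X ◁ η ≫ (α_ X D X).inv ≫ ev ▷ X ≫ (λ_ X).hom) ▷ D ⊗≫ ev := by
          rw [whisker_exchange]
          monoidal
        _ = _ := by
          rw [hη]
          monoidal
    rw [← cancel_mono (ρ_ D).hom]
    simpa using key

/-- An object with a dual `D` is a retract of `X ⊗ (D ⊗ X)`. -/
def retractTensorDual {T : Type u} [Category.{v} T] [MonoidalCategory T] (D X : T)
    [ExactPairing D X] : Retract X (X ⊗ (D ⊗ X)) where
  i := (ρ_ X).inv ≫ X ◁ η_ D X
  r := (α_ X D X).inv ≫ ε_ D X ▷ X ≫ (λ_ X).hom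
  retract := by
    have h := ExactPairing.coevaluation_evaluation_assoc D X (λ_ X).hom
    simp only [Category.assoc]
    rw [h]
    simp

/-- If the unit is compact, then duals are compact. -/
theorem IsCompactObj.of_exactPairing {T : Type u} [Category.{v} T] [Preadditive T]
    [HasCoproducts.{v} T] [MonoidalCategory T]
    (hT : ∀ (X : T) (J : Type v), PreservesColimitsOfShape (Discrete J) (tensorLeft X))
    (h1 : IsCompactObj (𝟙_ T)) (D X : T) [ExactPairing X D] : IsCompactObj D :=
  -- Duality identifies maps `D ⟶ W` with maps `𝟙 ⟶ X ⊗ W`.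
  h1.of_surjective (tensorLeft X) (hT X)
    (fun W g => (ρ_ D).inv ≫ ((tensorLeftAdjunction X D).homEquiv (𝟙_ T) W).symm g)
    (fun W f => ⟨(tensorLeftAdjunction X D).homEquiv (𝟙_ T) W ((ρ_ D).hom ≫ f), by simp⟩)
    (fun W W' g h => by
      rw [Adjunction.homEquiv_naturality_right_symm, Category.assoc])

/-! ### Distributivity and coherence of `Th(T^c)` -/

namespace TensorThick

variable {T : Type u} [Category.{v} T] [HasZeroObject T] [HasShift T ℤ] [Preadditive T]
  [∀ n : ℤ, (shiftFunctor T n).Additive] [Pretriangulated T] [MonoidalCategory T]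
  [HasCoproducts.{v} T]

theorem le_def {C D : TensorThick T} : C ≤ D ↔ ∀ X, C.prop X → D.prop X := Iff.rfl

theorem prop_of_iso (C : TensorThick T) {X Y : T} (e : X ≅ Y) (h : C.prop X) : C.prop Y :=
  C.retracts.of_retract (Retract.ofIso e.symm) h

theorem prop_tensor_left [BraidedCategory T] (C : TensorThick T) {X Y : T} (hX : IsCompactObj X)
    (hY : C.prop Y) : C.prop (X ⊗ Y) :=
  C.prop_of_iso (β_ Y X) (C.tensor Y X hY hX)

variable [IsCompactlyGeneratedTT T]

theorem isCompactObj_tensor {X Y : T} (hX : IsCompactObj X) (hY : IsCompactObj Y) :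
    IsCompactObj (X ⊗ Y) :=
  IsCompactObj.tensor IsTensorTriangulated.coproducts_left
    (IsCompactlyGeneratedTT.dualizable X hX) hY

/-- `X` is a retract of `X ⊗ (D ⊗ X) ≅ (X ⊗ X) ⊗ D`, with `D` compact. -/
theorem prop_of_prop_tensor_self [SymmetricCategory T] (C : TensorThick T) {X : T}
    (hX : IsCompactObj X) (h : C.prop (X ⊗ X)) : C.prop X := by
  obtain ⟨D, ⟨_⟩⟩ := (IsCompactlyGeneratedTT.dualizable X hX).exists_exactPairing
  have hD : IsCompactObj D :=
    letI := BraidedCategory.exactPairing_swap D X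
    IsCompactObj.of_exactPairing IsTensorTriangulated.coproducts_left
      IsCompactlyGeneratedTT.unit_compact D X
  refine C.retracts.of_retract (retractTensorDual D X) ?_
  exact C.prop_of_iso (α_ X X D ≪≫ whiskerLeftIso X (β_ X D)) (C.tensor _ _ h hD)

/-- The compact objects `W` with `Z ⊗ W ∈ C`. -/
def colon (C : TensorThick T) (Z : T) : TensorThick T where
  prop := IsCompactObj ⊓ C.prop.inverseImage (tensorLeft Z)
  le_compact _ h := h.1
  triangulated := by
    obtain ⟨_, _⟩ := IsTensorTriangulated.exact_left Z
    have := isCompactObj_triangulated (T := T)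
    have := isCompactObj_retracts (T := T)
    have := C.triangulated
    have := C.retracts
    infer_instance
  retracts :=
    { of_retract := fun r h => ⟨isCompactObj_retracts.of_retract r h.1,
        C.retracts.of_retract (r.map (tensorLeft Z)) h.2⟩ }
  tensor X Y hX hY := ⟨isCompactObj_tensor hX.1 hY,
    C.prop_of_iso (α_ Z X Y) (C.tensor _ Y hX.2 hY)⟩

theorem prop_inf_iff {C D : TensorThick T} {X : T} :
    (C ⊓ D).prop X ↔ C.prop X ∧ D.prop X := by
  refine ⟨fun h => ⟨le_def.1 inf_le_left X h, le_def.1 inf_le_right X h⟩, fun h => ?_⟩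
  refine ⟨C.le_compact X h.1, ?_⟩
  rintro E (rfl | rfl)
  exacts [h.1, h.2]

theorem prop_top_iff {X : T} : (⊤ : TensorThick T).prop X ↔ IsCompactObj X := by
  refine ⟨(⊤ : TensorThick T).le_compact X, fun h => ?_⟩
  exact le_def.1 (le_top : inter (∅ : Set (TensorThick T)) ≤ ⊤) X ⟨h, by simp⟩

/-- For `Z` in the left side, the colon ideal of the right side by `Z` contains `B` and `C`, hence
`Z`. So `Z ⊗ Z`, and therefore `Z`, lies in the right side. -/
theorem inf_sup_le [SymmetricCategory T] (A B C : TensorThick T) :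
    A ⊓ (B ⊔ C) ≤ A ⊓ B ⊔ A ⊓ C := by
  refine le_def.2 fun Z hZ => ?_
  rw [prop_inf_iff] at hZ
  have hcZ := A.le_compact Z hZ.1
  have key (E : TensorThick T) (hE : A ⊓ E ≤ A ⊓ B ⊔ A ⊓ C) : E ≤ (A ⊓ B ⊔ A ⊓ C).colon Z :=
    le_def.2 fun W hW => ⟨E.le_compact W hW, le_def.1 hE _ (prop_inf_iff.2
      ⟨A.tensor Z W hZ.1 (E.le_compact W hW), E.prop_tensor_left hcZ hW⟩)⟩
  exact prop_of_prop_tensor_self _ hcZ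
    (le_def.1 (sup_le (key B le_sup_left) (key C le_sup_right)) Z hZ.2).2

/-- The tensor closed thick subcategory generated by a compact object. -/
def gen (X : T) : TensorThick T := sInf {C | C.prop X}

theorem prop_gen {X : T} (hX : IsCompactObj X) : (gen X).prop X :=
  ⟨hX, fun _ hC => hC⟩

theorem gen_le_iff {X : T} (hX : IsCompactObj X) {C : TensorThick T} : gen X ≤ C ↔ C.prop X :=
  ⟨fun h => le_def.1 h X (prop_gen hX), fun h => sInf_le h⟩

/-- For `Z` in both ideals, two colon ideals replace the factors of `X ⊗ Y` in turn: first `Z ⊗ Y`,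
then `Z ⊗ Z`, lies in `gen (X ⊗ Y)`. -/
theorem gen_inf_gen [SymmetricCategory T] {X Y : T} (hX : IsCompactObj X) (hY : IsCompactObj Y) :
    gen X ⊓ gen Y = gen (X ⊗ Y) := by
  have hXY := isCompactObj_tensor hX hY
  refine le_antisymm (le_def.2 fun Z hZ => ?_) ((gen_le_iff hXY).2 (prop_inf_iff.2
    ⟨(gen X).tensor X Y (prop_gen hX) hY, (gen Y).prop_tensor_left hX (prop_gen hY)⟩))
  rw [prop_inf_iff] at hZ
  have hcZ := (gen X).le_compact Z hZ.1
  have h1 : gen X ≤ (gen (X ⊗ Y)).colon Y :=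
    (gen_le_iff hX).2 ⟨hX, prop_of_iso _ (β_ X Y) (prop_gen hXY)⟩
  have h2 : gen Y ≤ (gen (X ⊗ Y)).colon Z :=
    (gen_le_iff hY).2 ⟨hY, prop_of_iso _ (β_ Y Z) (le_def.1 h1 Z hZ.1).2⟩
  exact prop_of_prop_tensor_self _ hcZ (le_def.1 h2 Z hZ.2).2

theorem gen_unit : gen (𝟙_ T) = ⊤ :=
  top_le_iff.1 <| le_def.2 fun X hX => prop_of_iso _ (λ_ X)
    ((gen _).tensor _ X (prop_gen IsCompactlyGeneratedTT.unit_compact) (prop_top_iff.1 hX))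

/-- The union of a directed set of tensor closed thick subcategories. -/
def directedUnion (S : Set (TensorThick T)) (hS : S.Nonempty) (hdir : DirectedOn (· ≤ ·) S) :
    TensorThick T where
  prop X := ∃ C ∈ S, C.prop X
  le_compact := fun X ⟨C, _, hX⟩ => C.le_compact X hX
  triangulated :=
    { exists_zero := by
        obtain ⟨C, hC⟩ := hS
        have := C.triangulated
        have := C.retracts
        exact ⟨_, isZero_zero T, C, hC, C.prop.prop_zero⟩
      isStableUnderShiftBy := fun n => ⟨fun X ⟨C, hC, hX⟩ =>
        have := C.triangulated
        ⟨C, hC, C.prop.le_shift n X hX⟩⟩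
      ext₂' := by
        rintro A hA ⟨C, hC, h₁⟩ ⟨D, hD, h₃⟩
        obtain ⟨E, hE, hCE, hDE⟩ := hdir C hC D hD
        have := E.triangulated
        have := E.retracts
        exact ObjectProperty.le_isoClosure _ _ ⟨E, hE,
          E.prop.ext_of_isTriangulatedClosed₂ A hA (hCE _ h₁) (hDE _ h₃)⟩ }
  retracts := { of_retract := fun r ⟨C, hC, h⟩ => ⟨C, hC, C.retracts.of_retract r h⟩ }
  tensor := fun X Y ⟨C, hC, hX⟩ hY => ⟨C, hC, C.tensor X Y hX hY⟩

/-- A directed supremum is contained in the union, so `X` already lies in one member. -/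
theorem isCompactElement_gen {X : T} (hX : IsCompactObj X) : IsCompactElement (gen X) := by
  intro S u hS hdir hu hle
  have h : u ≤ directedUnion S hS hdir := hu.2 fun C hC => le_def.2 fun Y hY => ⟨C, hC, hY⟩
  obtain ⟨C, hC, hXC⟩ := (gen_le_iff hX).1 (hle.trans h)
  exact ⟨C, hC, (gen_le_iff hX).2 hXC⟩

theorem sSup_gen (C : TensorThick T) : sSup (gen '' {X | C.prop X}) = C := by
  refine le_antisymm (sSup_le ?_) (le_def.2 fun X hX => ?_)
  · rintro _ ⟨X, hX, rfl⟩
    exact (gen_le_iff (C.le_compact X hX)).2 hX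
  · exact (gen_le_iff (C.le_compact X hX)).1 (le_sSup ⟨X, hX, rfl⟩)

instance : IsCompactlyGenerated (TensorThick T) where
  exists_sSup_eq C := ⟨_, by
    rintro _ ⟨X, hX, rfl⟩
    exact isCompactElement_gen (C.le_compact X hX), sSup_gen C⟩

theorem isCompactElement_iff {C : TensorThick T} :
    IsCompactElement C ↔ ∃ X, IsCompactObj X ∧ C = gen X := by
  refine ⟨fun h => ?_, fun ⟨X, hX, hC⟩ => hC ▸ isCompactElement_gen hX⟩
  have := C.triangulated
  have := C.retracts
  obtain ⟨_, ⟨X, hX, rfl⟩, hCX⟩ := h (gen '' {X | C.prop X}) C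
    ⟨_, _, C.prop.prop_zero, rfl⟩ (by
      -- The principal ideals inside `C` are directed: `X` and `Y` are retracts of `X ⊞ Y`.
      rintro _ ⟨X, hX, rfl⟩ _ ⟨Y, hY, rfl⟩
      have hXY : C.prop (X ⊞ Y) := C.prop.ext_of_isTriangulatedClosed₂ _
        (binaryBiproductTriangle_distinguished X Y) hX hY
      have hc := C.le_compact _ hXY
      refine ⟨_, ⟨X ⊞ Y, hXY, rfl⟩, (gen_le_iff (C.le_compact X hX)).2 ?_,
        (gen_le_iff (C.le_compact Y hY)).2 ?_⟩
      · exact (gen _).retracts.of_retract ⟨biprod.inl, biprod.fst, by simp⟩ (prop_gen hc)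
      · exact (gen _).retracts.of_retract ⟨biprod.inr, biprod.snd, by simp⟩ (prop_gen hc))
    (by simpa only [sSup_gen] using isLUB_sSup (gen '' {X | C.prop X})) le_rfl
  exact ⟨X, C.le_compact X hX,
    le_antisymm hCX ((gen_le_iff (C.le_compact X hX)).2 hX)⟩

theorem supp_eq_U (C : TensorThick T) : C.supp = PrimeSp.U C := by
  ext P
  simp only [supp, suppObj, PrimeSp.U, Set.mem_iUnion, Set.mem_ofPred_eq, le_def, not_forall]
  exact ⟨fun ⟨X, hX, h⟩ => ⟨X.obj, hX, h⟩, fun ⟨X, hX, h⟩ => ⟨⟨X, C.le_compact X hX⟩, hX, h⟩⟩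

end TensorThick

theorem corollary7 (T : Type u) [Category.{v} T] [HasZeroObject T] [HasShift T ℤ] [Preadditive T]
    [∀ n : ℤ, (shiftFunctor T n).Additive] [Pretriangulated T] [IsTriangulated T]
    [MonoidalCategory T] [SymmetricCategory T] [HasCoproducts.{v} T]
    [IsCompactlyGeneratedTT T] :
    SpectralSpace (PrimeSp (TensorThick T)) ∧
    ∃ e : TensorThick T ≃o TopologicalSpace.Opens (PrimeSp (TensorThick T)),
      ∀ C : TensorThick T, (e C : Set (PrimeSp (TensorThick T))) = C.supp := by
  refine ⟨PrimeSp.spectralSpace TensorThick.inf_sup_le ?_ ?_,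
    PrimeSp.opensIso TensorThick.inf_sup_le, fun C => C.supp_eq_U.symm⟩
  · rw [← TensorThick.gen_unit]
    exact TensorThick.isCompactElement_gen IsCompactlyGeneratedTT.unit_compact
  · intro A B hA hB
    obtain ⟨X, hX, rfl⟩ := TensorThick.isCompactElement_iff.1 hA
    obtain ⟨Y, hY, rfl⟩ := TensorThick.isCompactElement_iff.1 hB
    rw [TensorThick.gen_inf_gen hX hY]
    exact TensorThick.isCompactElement_gen (TensorThick.isCompactObj_tensor hX hY)
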